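/- Work over $\mathbb{C}$. A projection $\mathbb{P}^3 \dashrightarrow \mathbb{P}^1$ is given by a $2\times 4$ matrix of rank $2$; its center is the line in $\mathbb{P}^3$ defined by the kernel of the matrix. Let $P=(P_1,\dots,P_4)$ and $Q=(Q_1,\dots,Q_4)$ be two $4$-tuples of such projections. A finite configuration of points $X_1,\dots,X_N\in\mathbb{P}^3$ is called critical (for the couple $P,Q$) if there are points $Y_1,\dots,Y_N\in\mathbb{P}^3$ such that $P_i(Y_j)=Q_i(X_j)$ (both sides being defined) for all $i$ and $j$, and such that no projective transformation of $\mathbb{P}^3$ sends $X_j$ to $Y_j$ for every $j$. The critical locus $\mathcal{X}=\mathcal{X}_{P,Q}\subseteq\mathbb{P}^3$ is the projective variety filled by these points, i.e. the Zariski closure of the set of all points that belong to some critical configuration. **Proposition.** For two general $4$-tuples $P,Q$ of projections $\mathbb{P}^3\dashrightarrow\mathbb{P}^1$ (that is, for all $P,Q$ outside the zero set of some nonzero polynomial in the $64$ entries of the matrices), the critical locus $\mathcal{X}$ is a smooth quartic determinantal surface: its homogeneous ideal is generated by a nonzero quartic form $F$ that is the determinant of a $4\times 4$ matrix of linear forms,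 $\mathcal{X}$ is the zero locus of $F$, and the gradient of $F$ does not vanish at any point of $\mathcal{X}$. Moreover, the homogeneous ideal of $\mathcal{X}$ is generated by the determinant of the $8\times 8$ matrix $$\begin{pmatrix} P_1 & Q_1(\mathbf{x}) & 0 & 0 & 0\\ P_2 & 0 & Q_2(\mathbf{x}) & 0 & 0\\ P_3 & 0 & 0 & Q_3(\mathbf{x}) & 0\\ P_4 & 0 & 0 & 0 & Q_4(\mathbf{x})\end{pmatrix},\qquad \mathbf{x}=(x_0,x_1,x_2,x_3)^T,$$ and $\mathcal{X}$ contains the centers of $Q_1,\dots,Q_4$, which are four pairwise skew lines. -/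

import Mathlib

open MvPolynomial

/-- Complex projective `3`-space. -/
abbrev P3 : Type := Projectivization ℂ (Fin 4 → ℂ)

/-- A `4`-tuple of `2 × 4` complex matrices; if all of them have rank `2`, these are the matrices
of four linear projections `ℙ³ ⇢ ℙ¹`. -/
abbrev Tuple4 : Type := Fin 4 → Matrix (Fin 2) (Fin 4) ℂ

/-- All four matrices have full rank, so that each of them defines a linear projection
`ℙ³ ⇢ ℙ¹`. -/
def IsProjTuple (P : Tuple4) : Prop := ∀ i, (P i).rank = 2

/-- The center of the projection `x ↦ A x`: the points of `ℙ³` where it is undefined. -/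
def center (A : Matrix (Fin 2) (Fin 4) ℂ) : Set P3 := {x | A.mulVec x.rep = 0}

/-- `A(y) = B(x)` as points of `ℙ¹`; both projections have to be defined at the points. -/
def SameImage (A B : Matrix (Fin 2) (Fin 4) ℂ) (y x : P3) : Prop :=
  ∃ (hA : A.mulVec y.rep ≠ 0) (hB : B.mulVec x.rep ≠ 0),
    Projectivization.mk ℂ (A.mulVec y.rep) hA = Projectivization.mk ℂ (B.mulVec x.rep) hB

/-- Two finite (indexed) configurations of points of `ℙ³` are projectively equivalent. -/
def ProjEquivalent {N : ℕ} (X Y : Fin N → P3) : Prop :=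
  ∃ g : (Fin 4 → ℂ) ≃ₗ[ℂ] (Fin 4 → ℂ),
    ∀ j, Projectivization.map g.toLinearMap g.injective (X j) = Y j

/-- `{X_j}` and `{Y_j}` are conjugate critical configurations, with associated couple of
projections `Q` (for the `X_j`) and `P` (for the `Y_j`): they have the same images
`P_i(Y_j) = Q_i(X_j)`, and they are not projectively equivalent. -/
def ConjugateCritical (P Q : Tuple4) {N : ℕ} (X Y : Fin N → P3) : Prop :=
  (∀ i j, SameImage (P i) (Q i) (Y j) (X j)) ∧ ¬ ProjEquivalent X Y

/-- The points of `ℙ³` that belong to a critical configuration for `Q` with conjugate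
projections `P`. -/
def criticalPoints (P Q : Tuple4) : Set P3 :=
  {x | ∃ (N : ℕ) (X Y : Fin N → P3), ConjugateCritical P Q X Y ∧ ∃ j, X j = x}

/-- The homogeneous ideal `I(S)` of a set of points of `ℙ³`: the polynomials that vanish on the
punctured cone over `S`. (Over an infinite field this is the ideal generated by the forms that
vanish on `S`.) -/
def projIdeal (S : Set P3) : Ideal (MvPolynomial (Fin 4) ℂ) where
  carrier := {f | ∀ (v : Fin 4 → ℂ) (hv : v ≠ 0), Projectivization.mk ℂ v hv ∈ S → eval v f = 0}
  zero_mem' := by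
    intro v _ _
    simp
  add_mem' := by
    intro f g hf hg v hv hS
    simp [hf v hv hS, hg v hv hS]
  smul_mem' := by
    intro c f hf v hv hS
    simp [hf v hv hS]

/-- The zero locus in `ℙ³` of a (homogeneous) ideal. -/
def projZeros (I : Ideal (MvPolynomial (Fin 4) ℂ)) : Set P3 :=
  {x | ∀ f ∈ I, ∀ (v : Fin 4 → ℂ) (hv : v ≠ 0), Projectivization.mk ℂ v hv = x → eval v f = 0}

/-- The critical locus: the projective variety filled by the points in critical configurations,
that is, the Zariski closure of this set of points. -/
def criticalLocus (P Q : Tuple4) : Set P3 := projZeros (projIdeal (criticalPoints P Q))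

/-- The `8 × 8` matrix of constants and linear forms whose `i`-th pair of rows is
`(P_i | 0 … Q_i(x) … 0)`, with the column `Q_i(x)` in the `i`-th of the last four places. -/
noncomputable def criticalMatrix (P Q : Tuple4) :
    Matrix (Fin 4 × Fin 2) (Fin 4 ⊕ Fin 4) (MvPolynomial (Fin 4) ℂ) :=
  fun r c => Sum.elim (fun k => C (P r.1 r.2 k))
    (fun j => if j = r.1 then ∑ k, C (Q r.1 r.2 k) * X k else 0) c

/-- The maximal minors of `criticalMatrix` (determinants for all identifications of the rows with
the columns, so that only signs differ). -/
def criticalMinors (P Q : Tuple4) : Set (MvPolynomial (Fin 4) ℂ) :=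
  {d | ∃ e : Fin 4 × Fin 2 ≃ Fin 4 ⊕ Fin 4, d = ((criticalMatrix P Q).submatrix id e).det}

/-- `S ⊆ ℙ³` is a smooth quartic determinantal surface: its ideal is generated by a nonzero
quartic form that is the determinant of a `4 × 4` matrix of linear forms, `S` is the zero locus
of this form, and the gradient of the form vanishes at no point of `S`. -/
def IsSmoothQuarticDeterminantal (S : Set P3) : Prop :=
  ∃ L : Matrix (Fin 4) (Fin 4) (MvPolynomial (Fin 4) ℂ),
    (∀ a b, (L a b).IsHomogeneous 1) ∧
    L.det ≠ 0 ∧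
    L.det.IsHomogeneous 4 ∧
    projIdeal S = Ideal.span {L.det} ∧
    S = projZeros (Ideal.span {L.det}) ∧
    ∀ (v : Fin 4 → ℂ) (hv : v ≠ 0), Projectivization.mk ℂ v hv ∈ S →
      ∃ k, eval v (pderiv k L.det) ≠ 0

/-- `S` is a line of `ℙ³`: the set of points of a `2`-dimensional linear subspace of `ℂ⁴`. -/
def IsProjLine (S : Set P3) : Prop :=
  ∃ W : Submodule ℂ (Fin 4 → ℂ), Module.finrank ℂ W = 2 ∧ S = {x | x.submodule ≤ W}

/-- The entries of two `4`-tuples of matrices, as a point of affine `64`-space. -/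
def entries (P Q : Tuple4) : (Fin 4 × Fin 2 × Fin 4) ⊕ (Fin 4 × Fin 2 × Fin 4) → ℂ :=
  Sum.elim (fun t => P t.1 t.2.1 t.2.2) (fun t => Q t.1 t.2.1 t.2.2)

/-- A property holds for two general `4`-tuples of projections `ℙ³ ⇢ ℙ¹`: it holds for all of
them outside some proper Zariski closed subset of the space of pairs of `4`-tuples of matrices,
that is, outside the zeros of some nonzero polynomial in the matrix entries. -/
def ForGeneralTuples (prop : Tuple4 → Tuple4 → Prop) : Prop :=
  ∃ D : MvPolynomial ((Fin 4 × Fin 2 × Fin 4) ⊕ (Fin 4 × Fin 2 × Fin 4)) ℂ, D ≠ 0 ∧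
    ∀ P Q : Tuple4, IsProjTuple P → IsProjTuple Q → eval (entries P Q) D ≠ 0 → prop P Q

/-!
For vectors `x`, `y` the points `P_i y` and `Q_i x` of the projective line agree exactly when both
are defined and the bilinear form `B_i(y, x) = (P_i y)₀ (Q_i x)₁ - (P_i y)₁ (Q_i x)₀` vanishes. The
forms `B_i(·, x)` are the rows of a `4 × 4` matrix `linMat P Q` of linear forms in `x`, and a solution
`y ≠ 0` of the four equations exists exactly when its determinant, the `quartic`, vanishes at `x`.
Eliminating the last four columns of the `8 × 8` matrix shows that its determinant is the same quartic
up to sign.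

*General tuples.* The open conditions needed are collected in `IsGeneralPair`. Each of them is the
nonvanishing of a polynomial in the matrix entries, and one pair of tuples, with quartic
`x₀⁴ - x₁⁴ - x₂⁴ + x₃⁴`, satisfies them all; so they hold for general tuples
(`exists_polynomial_isGeneralPair`). For smoothness the polynomial is a determinant going back to
Macaulay: the common zeros of four cubic forms give kernel vectors of a square matrix formed from their
coefficients, which is diagonal for the cubes of the variables
(`eq_zero_of_det_macaulayMatrix_ne_zero`, `det_macaulayMatrix_cubes_ne_zero`).

*The ideal of the critical locus.* A smooth form in four variables is irreducible, because two factors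
vanishing at the origin have another common zero by Krull's height theorem, and the product is singular
there (`irreducible_of_smooth`). At a point of the quartic outside certain surfaces of degrees `1` and
`3`, the adjugate of `linMat P Q` provides a conjugate point `y`. Since the quartic is irreducible of
degree `4`, these regular points are dense on it by the Nullstellensatz (`IsGeneralPair.quartic_dvd`).
They are critical: if a linear map `g` takes all of them to their conjugates, the quadratic forms
`B_i(g x, x)` vanish on the quartic, hence are zero, and this forces `g = 0` for general tuples. As the
conditions on `g` are linear, finitely many of the points suffice to exclude all `g ≠ 0`
(`IsGeneralPair.mk_mem_criticalPoints`).
-/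

/-! ### Forms without common zeros -/

/-- The monomials of degree `9` in four variables. This is the least degree in which every monomial is
divisible by the cube of a variable. -/
abbrev NonicExponent : Type := {m : Fin 4 →₀ ℕ // m.degree = 9}

lemma finite_setOf_degree_eq (d : ℕ) : {m : Fin 4 →₀ ℕ | m.degree = d}.Finite := by
  refine (Finset.finite_toSet (Finset.univ.finsuppAntidiag d)).subset fun m hm => ?_
  simpa [Finset.mem_finsuppAntidiag, Finsupp.degree_eq_sum] using hm

noncomputable instance : Fintype NonicExponent := (finite_setOf_degree_eq 9).fintype

lemma NonicExponent.exists_three_le (m : NonicExponent) : ∃ k, 3 ≤ m.1 k := by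
  by_contra! h
  have h9 := m.2
  rw [Finsupp.degree_eq_sum, Fin.sum_univ_four] at h9
  have := h 0; have := h 1; have := h 2; have := h 3
  omega

/-- A variable whose cube divides a given monomial of degree `9`. -/
noncomputable def NonicExponent.cubeVar (m : NonicExponent) : Fin 4 := m.exists_three_le.choose

lemma NonicExponent.single_cubeVar_le (m : NonicExponent) :
    Finsupp.single m.cubeVar 3 ≤ m.1 := by
  rw [Finsupp.single_le_iff]
  exact m.exists_three_le.choose_spec

/-- Macaulay's matrix of four cubic forms `g₀, …, g₃`: its row at a monomial `x^m` of degree `9`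
lists the coefficients of `(x^m / x_k³) g_k`, where `k` is chosen so that `x_k³` divides `x^m`. -/
noncomputable def macaulayMatrix {R : Type*} [CommRing R] (g : Fin 4 → MvPolynomial (Fin 4) R) :
    Matrix NonicExponent NonicExponent R :=
  Matrix.of fun m n => coeff n.1 (monomial (m.1 - Finsupp.single m.cubeVar 3) 1 * g m.cubeVar)

lemma macaulayMatrix_map {R S : Type*} [CommRing R] [CommRing S] (φ : R →+* S)
    (g : Fin 4 → MvPolynomial (Fin 4) R) :
    (macaulayMatrix g).map φ = macaulayMatrix fun k => map φ (g k) := by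
  ext m n
  have h : map φ (monomial (m.1 - Finsupp.single m.cubeVar 3) 1 * g m.cubeVar)
      = monomial (m.1 - Finsupp.single m.cubeVar 3) 1 * map φ (g m.cubeVar) := by simp
  simp only [macaulayMatrix, Matrix.map_apply, Matrix.of_apply, ← h, coeff_map]

/-- At a common zero of the forms, the vector of all monomials of degree `9` lies in the kernel of
Macaulay's matrix. -/
lemma eq_zero_of_det_macaulayMatrix_ne_zero {K : Type*} [Field K]
    {g : Fin 4 → MvPolynomial (Fin 4) K} (hg : ∀ k, (g k).IsHomogeneous 3)
    (hdet : (macaulayMatrix g).det ≠ 0) {v : Fin 4 → K} (hv : ∀ k, eval v (g k) = 0) : v = 0 := by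
  have hker : (macaulayMatrix g).mulVec (fun n => ∏ i, v i ^ n.1 i) = 0 := by
    ext m
    set p := monomial (m.1 - Finsupp.single m.cubeVar 3) 1 * g m.cubeVar with hp
    have hdeg : (m.1 - Finsupp.single m.cubeVar 3).degree = 6 := by
      have h := congrArg Finsupp.degree (tsub_add_cancel_of_le m.single_cubeVar_le)
      rw [map_add, m.2, Finsupp.degree_single] at h
      omega
    have hhom : p.IsHomogeneous 9 := (isHomogeneous_monomial 1 hdeg).mul (hg m.cubeVar)
    have heval : eval v p = 0 := by rw [hp, map_mul, hv, mul_zero]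
    rw [eval_eq'] at heval
    have hsupp : p.support ⊆ (finite_setOf_degree_eq 9).toFinset := fun d hd => by
      rw [Set.Finite.mem_toFinset, Set.mem_ofPred_eq]
      have := hhom (mem_support_iff.1 hd)
      rwa [Finsupp.degree_eq_weight_one]
    rw [Finset.sum_subset hsupp fun d _ hd => by
      rw [notMem_support_iff.1 hd, zero_mul]] at heval
    rw [Pi.zero_apply, ← heval]
    exact (Finset.sum_subtype _ (p := fun d : Fin 4 →₀ ℕ => d.degree = 9) (fun d => by simp)
      (fun d => coeff d p * ∏ i, v i ^ d i)).symm
  have hmon := Matrix.eq_zero_of_mulVec_eq_zero hdet hker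
  ext k
  have hk := congrFun hmon ⟨Finsupp.single k 9, by simp⟩
  rw [Pi.zero_apply, Finset.prod_eq_zero_iff] at hk
  obtain ⟨i, -, hi⟩ := hk
  obtain rfl : i = k := by
    by_contra hne
    rw [Finsupp.single_eq_of_ne hne, pow_zero] at hi
    exact one_ne_zero hi
  rw [Finsupp.single_eq_same] at hi
  exact (pow_eq_zero_iff (by norm_num)).1 hi

lemma det_macaulayMatrix_cubes_ne_zero {K : Type*} [Field K] {c : Fin 4 → K}
    (hc : ∀ k, c k ≠ 0) : (macaulayMatrix fun k => monomial (Finsupp.single k 3) (c k)).det ≠ 0 := by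
  have h : (macaulayMatrix fun k => monomial (Finsupp.single k 3) (c k))
      = Matrix.diagonal fun m : NonicExponent => c m.cubeVar := by
    ext m n
    simp only [macaulayMatrix, Matrix.of_apply, monomial_mul, one_mul,
      tsub_add_cancel_of_le m.single_cubeVar_le, coeff_monomial, Matrix.diagonal_apply,
      Subtype.ext_iff]
  rw [h, Matrix.det_diagonal]
  exact Finset.prod_ne_zero_iff.2 fun m _ => hc _

/-! ### Irreducibility of smooth forms -/

/-- The ideal of the linear subspace on which the first `k` coordinates vanish, as the kernel of the
restriction of polynomials to this subspace. -/
noncomputable def coordIdeal (k : ℕ) : Ideal (MvPolynomial (Fin 4) ℂ) :=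
  RingHom.ker (aeval (R := ℂ) fun i : Fin 4 =>
    if i.1 < k then (0 : MvPolynomial (Fin 4) ℂ) else X i).toRingHom

instance (k : ℕ) : (coordIdeal k).IsPrime := RingHom.ker_isPrime _

lemma mem_coordIdeal {k : ℕ} {f : MvPolynomial (Fin 4) ℂ} :
    f ∈ coordIdeal k ↔ aeval (R := ℂ) (fun i : Fin 4 =>
      if i.1 < k then (0 : MvPolynomial (Fin 4) ℂ) else X i) f = 0 := Iff.rfl

lemma coordIdeal_lt_succ {k : ℕ} (hk : k < 4) : coordIdeal k < coordIdeal (k + 1) := by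
  refine SetLike.lt_iff_le_and_exists.2 ⟨fun f hf => ?_, X ⟨k, hk⟩, ?_, ?_⟩
  · rw [mem_coordIdeal] at hf ⊢
    have h := congrArg (aeval (R := ℂ) fun i : Fin 4 =>
      if i.1 < k + 1 then (0 : MvPolynomial (Fin 4) ℂ) else X i) hf
    rw [map_zero, ← AlgHom.comp_apply, comp_aeval] at h
    convert h using 3
    ext1 i
    split_ifs <;> simp <;> omega
  · simp [mem_coordIdeal]
  · simp [mem_coordIdeal, X_ne_zero]

lemma four_le_height_coordIdeal : 4 ≤ (coordIdeal 4).height := by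
  have key : ∀ k : ℕ, k ≤ 4 → (k : ℕ∞) ≤ (coordIdeal k).height := by
    intro k
    induction k with
    | zero => simp
    | succ k ih =>
      intro hk
      have hlt := Ideal.height_strict_mono_of_isPrime_of_isPrime (coordIdeal_lt_succ hk)
      push_cast
      exact (add_le_add_left (ih (by omega)) 1).trans (Order.add_one_le_of_lt hlt)
  exact key 4 le_rfl

lemma mem_coordIdeal_four {f : MvPolynomial (Fin 4) ℂ} :
    f ∈ coordIdeal 4 ↔ eval 0 f = 0 := by
  rw [mem_coordIdeal]
  have : (fun i : Fin 4 => if i.1 < 4 then (0 : MvPolynomial (Fin 4) ℂ) else X i)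
      = fun i => 0 := by ext1 i; simp
  rw [this]
  have h2 : aeval (R := ℂ) (fun _ : Fin 4 => (0 : MvPolynomial (Fin 4) ℂ)) f = C (eval 0 f) := by
    have h : aeval (R := ℂ) (fun _ : Fin 4 => (0 : MvPolynomial (Fin 4) ℂ))
        = (Algebra.ofId ℂ (MvPolynomial (Fin 4) ℂ)).comp (aeval 0) := by
      ext i
      simp
    exact DFunLike.congr_fun h f
  rw [h2, C_eq_zero]

/-- By Krull's height theorem, the origin is not an isolated common zero of two polynomials in four
variables. -/
lemma exists_ne_zero_common_zero {g h : MvPolynomial (Fin 4) ℂ} (hg : eval 0 g = 0)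
    (hh : eval 0 h = 0) : ∃ v : Fin 4 → ℂ, v ≠ 0 ∧ eval v g = 0 ∧ eval v h = 0 := by
  by_contra! hcon
  set J : Ideal (MvPolynomial (Fin 4) ℂ) := Ideal.span {g, h} with hJ
  have hzero : zeroLocus ℂ J = {0} := by
    ext v
    rw [zeroLocus_span]
    simp only [Set.mem_insert_iff, Set.mem_singleton_iff, forall_eq_or_imp, forall_eq,
      Set.mem_ofPred_eq]
    refine ⟨fun hv => ?_, fun hv => ?_⟩
    · by_contra hv0
      exact hcon v hv0 (by simpa using hv.1) (by simpa using hv.2)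
    · subst hv; exact ⟨hg, hh⟩
  have hrad : J.radical = coordIdeal 4 := by
    rw [← vanishingIdeal_zeroLocus_eq_radical (K := ℂ), hzero]
    ext f
    simp [mem_coordIdeal_four]
  have hmin : coordIdeal 4 ∈ J.minimalPrimes := by
    rw [← Ideal.radical_minimalPrimes, hrad, Ideal.minimalPrimes_eq_subsingleton_self]
    rfl
  have hle := Ideal.height_le_card_of_mem_minimalPrimes_span (s := {g, h}) (by simp) hmin
  have hcard : (({g, h} : Set (MvPolynomial (Fin 4) ℂ)).ncard : ℕ∞) ≤ 2 := by
    exact_mod_cast (Set.ncard_insert_le g {h}).trans (by simp)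
  exact absurd (four_le_height_coordIdeal.trans (hle.trans hcard)) (by decide)

lemma eval_smul_of_isHomogeneous {f : MvPolynomial (Fin 4) ℂ} {d : ℕ} (hf : f.IsHomogeneous d)
    (t : ℂ) (v : Fin 4 → ℂ) : eval (t • v) f = t ^ d * eval v f := by
  rw [eval_eq', eval_eq', Finset.mul_sum]
  refine Finset.sum_congr rfl fun m hm => ?_
  have hdeg : m.degree = d := by
    rw [Finsupp.degree_eq_weight_one]
    exact hf (mem_support_iff.1 hm)
  simp only [Pi.smul_apply, smul_eq_mul, mul_pow, Finset.prod_mul_distrib, Finset.prod_pow_eq_pow_sum]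
  rw [← Finsupp.degree_eq_sum, hdeg]
  ring

/-- Along the lines through the origin a homogeneous product is a monomial; hence so are its factors,
and a factor that does not vanish at the origin is constant. -/
lemma isUnit_of_mul_isHomogeneous {f g h : MvPolynomial (Fin 4) ℂ} {d : ℕ}
    (hf : f.IsHomogeneous d) (hf0 : f ≠ 0) (hfgh : f = g * h) (hg : eval 0 g ≠ 0) : IsUnit g := by
  have key : f * (g - C (eval 0 g)) = 0 := by
    refine MvPolynomial.funext fun v => ?_
    by_cases hv : eval v f = 0
    · simp [hv]
    -- Restriction of polynomials to the line through `v`, with parameter `t ↦ t • v`.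
    let ψ : MvPolynomial (Fin 4) ℂ →ₐ[ℂ] Polynomial ℂ :=
      aeval fun i => Polynomial.C (v i) * Polynomial.X
    have hψ : ∀ (t : ℂ) (p : MvPolynomial (Fin 4) ℂ), (ψ p).eval t = eval (t • v) p := fun t p => by
      have h : (Polynomial.aeval t).comp ψ = aeval (t • v) := by
        ext i
        simp only [ψ, AlgHom.comp_apply, aeval_X, map_mul, Polynomial.aeval_C, Polynomial.aeval_X,
          Pi.smul_apply, smul_eq_mul, Algebra.algebraMap_self, RingHom.id_apply]
        ring
      have := DFunLike.congr_fun h p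
      simpa [Polynomial.coe_aeval_eq_eval, aeval_eq_eval] using this
    have hprod : ψ g * ψ h = Polynomial.C (eval v f) * Polynomial.X ^ d := by
      refine Polynomial.funext fun t => ?_
      rw [← map_mul, ← hfgh, hψ, eval_smul_of_isHomogeneous hf]
      simp only [Polynomial.eval_mul, Polynomial.eval_C, Polynomial.eval_pow, Polynomial.eval_X]
      ring
    have hdvd : ψ g ∣ Polynomial.X ^ d :=
      ((Polynomial.isUnit_C.2 (isUnit_iff_ne_zero.2 hv)).dvd_mul_left).1 ⟨_, hprod.symm⟩
    obtain ⟨k, -, hk⟩ := (dvd_prime_pow Polynomial.prime_X d).1 hdvd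
    have hg0 : (ψ g).eval 0 = eval 0 g := by rw [hψ, zero_smul]
    have hk0 : k = 0 := by
      by_contra hne
      obtain ⟨q, hq⟩ := hk.symm.dvd
      rw [hq, Polynomial.eval_mul, Polynomial.eval_pow, Polynomial.eval_X, zero_pow hne,
        zero_mul] at hg0
      exact hg hg0.symm
    subst hk0
    obtain ⟨c, -, hc⟩ := Polynomial.isUnit_iff.1 (associated_one_iff_isUnit.1 (by simpa using hk))
    have hg1 := hψ 1 g
    rw [← hc, Polynomial.eval_C] at hg0 hg1
    rw [one_smul] at hg1
    simp only [map_mul, map_sub, eval_C, ← hg1, ← hg0, sub_self, mul_zero, map_zero]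
  have hgc := sub_eq_zero.1 ((mul_eq_zero.1 key).resolve_left hf0)
  rw [hgc]
  exact (isUnit_iff_ne_zero.2 hg).map C

/-- A reducible form is singular where two of its factors vanish simultaneously. -/
lemma irreducible_of_smooth {f : MvPolynomial (Fin 4) ℂ} {d : ℕ} (hf : f.IsHomogeneous d)
    (hd : d ≠ 0) (hsm : ∀ v, (∀ k, eval v (pderiv k f) = 0) → v = 0) : Irreducible f := by
  have hf0 : f ≠ 0 := by
    rintro rfl
    simpa using hsm 1 (by simp)
  have heval0 : eval 0 f = 0 := by
    simpa [hd] using eval_smul_of_isHomogeneous hf 0 0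
  refine ⟨fun hu => ?_, fun g h hfgh => ?_⟩
  · exact (hu.map (eval 0)).ne_zero heval0
  by_cases hg : eval 0 g = 0
  · by_cases hh : eval 0 h = 0
    · obtain ⟨v, hv, hgv, hhv⟩ := exists_ne_zero_common_zero hg hh
      exact absurd (hsm v fun k => by simp [hfgh, hgv, hhv]) hv
    · exact .inr (isUnit_of_mul_isHomogeneous hf hf0 (hfgh.trans (mul_comm g h)) hh)
  · exact .inl (isUnit_of_mul_isHomogeneous hf hf0 hfgh hg)

/-! ### The determinantal quartic -/

/-- A `4`-tuple of `2 × 4` matrices over an arbitrary ring. -/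
abbrev TupleOver (R : Type*) : Type _ := Fin 4 → Matrix (Fin 2) (Fin 4) R

/-- Base change of a tuple of matrices along a ring homomorphism. -/
abbrev TupleOver.map {R S : Type*} [CommRing R] [CommRing S] (φ : R →+* S) (P : TupleOver R) :
    TupleOver S := fun i => (P i).map φ

section CommRing

variable {R S : Type*} [CommRing R] [CommRing S]

/-- The matrix of the bilinear form `B_i(y, x) = (P_i y)₀ (Q_i x)₁ - (P_i y)₁ (Q_i x)₀`, which
vanishes when `P_i y` and `Q_i x` are proportional. -/
def incidenceForm (P Q : TupleOver R) (i : Fin 4) : Matrix (Fin 4) (Fin 4) R :=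
  Matrix.of fun p k => P i 0 p * Q i 1 k - P i 1 p * Q i 0 k

/-- The value at `x = v` of the `4 × 4` matrix of linear forms whose `i`-th row is `B_i(·, x)`. -/
def linMatAt (P Q : TupleOver R) (v : Fin 4 → R) : Matrix (Fin 4) (Fin 4) R :=
  Matrix.of fun i p => ∑ k, incidenceForm P Q i p k * v k

/-- The `4 × 4` matrix of linear forms in `x` whose `i`-th row is the linear form `B_i(·, x)`. -/
noncomputable def linMat (P Q : TupleOver R) : Matrix (Fin 4) (Fin 4) (MvPolynomial (Fin 4) R) :=
  Matrix.of fun i p => ∑ k, C (incidenceForm P Q i p k) * X k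

/-- The quartic form cutting out the critical locus. -/
noncomputable def quartic (P Q : TupleOver R) : MvPolynomial (Fin 4) R := (linMat P Q).det

/-- The cubic form `(P_i y)₀`, where `y` is the first column of the adjugate of `linMat P Q`. On the
zero locus of the quartic this `y` solves `B_i(y, x) = 0` for all `i`. -/
noncomputable def kernelCubic (P Q : TupleOver R) (i : Fin 4) : MvPolynomial (Fin 4) R :=
  ∑ p, C (P i 0 p) * (linMat P Q).adjugate p 0

/-- The value of `kernelCubic P Q i` at `v`. -/
def kernelCubicAt (P Q : TupleOver R) (v : Fin 4 → R) (i : Fin 4) : R :=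
  ∑ p, P i 0 p * (linMatAt P Q v).adjugate p 0

/-- The matrix of a linear system in the entries of a `4 × 4` matrix `g`: the equations say that for
each `i` the coefficients of `x₀²`, `x₀x₁`, `x₂²`, `x₂x₃` in the quadratic form `B_i(g x, x)` vanish
(the coefficients of the squares being doubled). -/
def quadricSystem (P Q : TupleOver R) : Matrix (Fin 4 × Fin 4) (Fin 4 × Fin 4) R :=
  Matrix.of fun it pq =>
    incidenceForm P Q it.1 pq.1 (![0, 0, 2, 2] it.2) * (if pq.2 = ![0, 1, 2, 3] it.2 then 1 else 0)
    + incidenceForm P Q it.1 pq.1 (![0, 1, 2, 3] it.2) *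
      (if pq.2 = ![0, 0, 2, 2] it.2 then 1 else 0)

/-- The four rows of two `2 × 4` matrices. -/
def stack (A B : Matrix (Fin 2) (Fin 4) R) : Matrix (Fin 4) (Fin 4) R :=
  Matrix.of ![A 0, A 1, B 0, B 1]

lemma incidenceForm_map (φ : R →+* S) (P Q : TupleOver R) (i p k : Fin 4) :
    φ (incidenceForm P Q i p k) = incidenceForm (P.map φ) (Q.map φ) i p k := by
  simp [incidenceForm]

lemma linMatAt_map (φ : R →+* S) (P Q : TupleOver R) (v : Fin 4 → R) :
    (linMatAt P Q v).map φ = linMatAt (P.map φ) (Q.map φ) (φ ∘ v) := by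
  ext i p
  simp [linMatAt, incidenceForm_map]

lemma quartic_map (φ : R →+* S) (P Q : TupleOver R) :
    map φ (quartic P Q) = quartic (P.map φ) (Q.map φ) := by
  rw [quartic, RingHom.map_det]
  congr 1
  ext1 i p
  rw [RingHom.mapMatrix_apply, Matrix.map_apply, linMat, linMat, Matrix.of_apply, Matrix.of_apply,
    map_sum]
  simp_rw [map_mul, map_C, map_X, incidenceForm_map]

lemma det_macaulayMatrix_quartic_map (φ : R →+* S) (P Q : TupleOver R) :
    φ (macaulayMatrix fun k => pderiv k (quartic P Q)).det
      = (macaulayMatrix fun k => pderiv k (quartic (P.map φ) (Q.map φ))).det := by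
  rw [RingHom.map_det, RingHom.mapMatrix_apply, macaulayMatrix_map]
  simp_rw [← pderiv_map, quartic_map]

lemma det_quadricSystem_map (φ : R →+* S) (P Q : TupleOver R) :
    φ (quadricSystem P Q).det = (quadricSystem (P.map φ) (Q.map φ)).det := by
  rw [RingHom.map_det]
  congr 1
  ext1 it pq
  simp [quadricSystem, incidenceForm_map, apply_ite φ]

lemma kernelCubicAt_map (φ : R →+* S) (P Q : TupleOver R) (v : Fin 4 → R) (i : Fin 4) :
    φ (kernelCubicAt P Q v i) = kernelCubicAt (P.map φ) (Q.map φ) (φ ∘ v) i := by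
  have h := RingHom.map_adjugate φ (linMatAt P Q v)
  rw [RingHom.mapMatrix_apply, RingHom.mapMatrix_apply, linMatAt_map] at h
  simp [kernelCubicAt, ← h]

lemma det_stack_map (φ : R →+* S) (A B : Matrix (Fin 2) (Fin 4) R) :
    φ (stack A B).det = (stack (A.map φ) (B.map φ)).det := by
  rw [RingHom.map_det]
  congr 1
  ext1 a k
  fin_cases a <;> rfl

lemma eval_linMat (P Q : TupleOver R) (v : Fin 4 → R) :
    (linMat P Q).map (eval v) = linMatAt P Q v := by
  ext i p
  simp [linMat, linMatAt]

lemma eval_quartic (P Q : TupleOver R) (v : Fin 4 → R) :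
    eval v (quartic P Q) = (linMatAt P Q v).det := by
  rw [quartic, RingHom.map_det, RingHom.mapMatrix_apply, eval_linMat]

lemma eval_kernelCubic (P Q : TupleOver R) (v : Fin 4 → R) (i : Fin 4) :
    eval v (kernelCubic P Q i) = kernelCubicAt P Q v i := by
  have h := RingHom.map_adjugate (eval v) (linMat P Q)
  rw [RingHom.mapMatrix_apply, RingHom.mapMatrix_apply, eval_linMat] at h
  simp [kernelCubicAt, kernelCubic, ← h]

lemma linMat_isHomogeneous (P Q : TupleOver R) (i p : Fin 4) : (linMat P Q i p).IsHomogeneous 1 := by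
  rw [linMat, Matrix.of_apply]
  exact IsHomogeneous.sum _ _ _ fun _ _ => isHomogeneous_C_mul_X _ _

lemma isHomogeneous_det {n : ℕ} {M : Matrix (Fin n) (Fin n) (MvPolynomial (Fin 4) R)}
    {e : Fin n → ℕ} (hM : ∀ i j, (M i j).IsHomogeneous (e j)) :
    M.det.IsHomogeneous (∑ j, e j) := by
  rw [Matrix.det_apply]
  refine IsHomogeneous.sum _ _ _ fun σ _ => ?_
  have h : (∏ j, M (σ j) j).IsHomogeneous (∑ j, e j) := IsHomogeneous.prod _ _ _ fun j _ => hM _ _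
  rcases Int.units_eq_one_or (Equiv.Perm.sign σ) with hs | hs <;> rw [hs]
  · simpa using h
  · simpa using h.neg

lemma quartic_isHomogeneous (P Q : TupleOver R) : (quartic P Q).IsHomogeneous 4 := by
  exact isHomogeneous_det (e := fun _ => 1) fun i p => linMat_isHomogeneous P Q i p

lemma kernelCubic_isHomogeneous (P Q : TupleOver R) (i : Fin 4) :
    (kernelCubic P Q i).IsHomogeneous 3 := by
  refine IsHomogeneous.sum _ _ _ fun p _ => IsHomogeneous.C_mul ?_ _
  rw [Matrix.adjugate_apply, ← Matrix.det_transpose]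
  -- After transposition, the column `0` is a constant vector, and the others consist of linear forms.
  have h := isHomogeneous_det (M := ((linMat P Q).updateRow 0 (Pi.single p 1)).transpose)
    (e := fun j => if j = 0 then 0 else 1) fun a j => by
      rw [Matrix.transpose_apply, Matrix.updateRow_apply]
      split_ifs
      · rw [Pi.single_apply]
        split_ifs
        · exact isHomogeneous_one _ _
        · exact isHomogeneous_zero _ _ _
      · exact linMat_isHomogeneous P Q j a
  simpa [Fin.sum_univ_four] using h

end CommRing

lemma linMatAt_mulVec (P Q : Tuple4) (x y : Fin 4 → ℂ) (i : Fin 4) :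
    (linMatAt P Q x).mulVec y i
      = (P i).mulVec y 0 * (Q i).mulVec x 1 - (P i).mulVec y 1 * (Q i).mulVec x 0 := by
  simp only [Matrix.mulVec, dotProduct, linMatAt, incidenceForm, Matrix.of_apply, Fin.sum_univ_four]
  ring

lemma linMatAt_mulVec_adjugate (P Q : Tuple4) (x : Fin 4 → ℂ) :
    (linMatAt P Q x).mulVec (fun p => (linMatAt P Q x).adjugate p 0)
      = Pi.single 0 (linMatAt P Q x).det := by
  have h := Matrix.mul_adjugate (linMatAt P Q x)
  ext i
  have h2 := congrFun (congrFun h i) 0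
  rw [Matrix.mul_apply] at h2
  rw [Matrix.mulVec, dotProduct, h2]
  simp [Matrix.one_apply, Pi.single_apply]

/-! ### Conditions on general tuples -/

/-- The index set of the entries of two `4`-tuples of matrices. -/
abbrev EntryIndex : Type := (Fin 4 × Fin 2 × Fin 4) ⊕ (Fin 4 × Fin 2 × Fin 4)

/-- A quantity that is given by an integral formula in the entries of `P` and `Q`, hence is compatible
with ring homomorphisms, is a polynomial in the entries: evaluate the formula at the tuples of
indeterminates. -/
lemma exists_eval_entries_eq (f : ∀ (R : Type) [CommRing R], TupleOver R → TupleOver R → R)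
    (hf : ∀ (R S : Type) [CommRing R] [CommRing S] (φ : R →+* S) (P Q : TupleOver R),
      φ (f R P Q) = f S (P.map φ) (Q.map φ)) :
    ∃ D : MvPolynomial EntryIndex ℂ, ∀ P Q : Tuple4, eval (entries P Q) D = f ℂ P Q := by
  refine ⟨f _ (fun i => Matrix.of fun a k => X (.inl (i, a, k)))
    (fun i => Matrix.of fun a k => X (.inr (i, a, k))), fun P Q => ?_⟩
  rw [hf]
  congr 1
  · ext i a k
    simp [entries]
  · ext i a k
    simp [entries]

/-! ### A pair of tuples for which the quartic is the Fermat quartic -/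

/-- The tuple of projections with rows `e_i`, `e_{i+1}`. -/
def fermatP : Tuple4 := fun i => Matrix.of ![Pi.single i 1, Pi.single (i + 1) 1]

/-- The tuple of projections with rows `m_i = x₂ - ζ x₃`, `l_i = x₀ - ζ x₁`, where `ζ` is the `i`-th
power of the imaginary unit. The quartic is `∏ l_i - ∏ m_i = x₀⁴ - x₁⁴ - x₂⁴ + x₃⁴`. -/
noncomputable def fermatQ : Tuple4 := fun i =>
  Matrix.of ![![0, 0, 1, -Complex.I ^ i.1], ![1, -Complex.I ^ i.1, 0, 0]]

lemma linMatAt_fermat_mulVec (x y : Fin 4 → ℂ) (i : Fin 4) :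
    (linMatAt fermatP fermatQ x).mulVec y i
      = (x 0 - Complex.I ^ i.1 * x 1) * y i - (x 2 - Complex.I ^ i.1 * x 3) * y (i + 1) := by
  rw [linMatAt_mulVec]
  simp [fermatP, fermatQ, Matrix.mulVec, dotProduct, Fin.sum_univ_four (f := fun k => _ * x k),
    Pi.single_apply]
  ring

lemma quartic_fermat : quartic fermatP fermatQ = X 0 ^ 4 - X 1 ^ 4 - X 2 ^ 4 + X 3 ^ 4 := by
  have hJ : (C Complex.I : MvPolynomial (Fin 4) ℂ) ^ 2 = -1 := by
    rw [← C_pow, Complex.I_sq, C_neg, C_1]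
  have hM : linMat fermatP fermatQ =
      !![X 0 - X 1, -(X 2 - X 3), 0, 0;
        0, X 0 - C Complex.I * X 1, -(X 2 - C Complex.I * X 3), 0;
        0, 0, X 0 + X 1, -(X 2 + X 3);
        -(X 2 + C Complex.I * X 3), 0, 0, X 0 + C Complex.I * X 1] := by
    ext1 i p
    fin_cases i <;> fin_cases p <;>
      simp [linMat, incidenceForm, fermatP, fermatQ, Fin.sum_univ_four, Pi.single_apply,
        pow_succ] <;> ring
  rw [quartic, hM]
  simp [Matrix.det_succ_row_zero, Fin.sum_univ_succ, Fin.succAbove]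
  linear_combination (-(X 0 ^ 2 - X 1 ^ 2) * X 1 ^ 2 + (X 2 ^ 2 - X 3 ^ 2) * X 3 ^ 2) * hJ

lemma pderiv_quartic_fermat (k : Fin 4) : pderiv k (quartic fermatP fermatQ)
    = monomial (Finsupp.single k 3) (![4, -4, -4, 4] k) := by
  rw [quartic_fermat]
  fin_cases k <;> simp [pderiv_X, ← C_mul_X_pow_eq_monomial, map_ofNat C 4]

lemma det_macaulayMatrix_fermat_ne_zero :
    (macaulayMatrix fun k => pderiv k (quartic fermatP fermatQ)).det ≠ 0 := by
  simp_rw [pderiv_quartic_fermat]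
  refine det_macaulayMatrix_cubes_ne_zero fun k => ?_
  fin_cases k <;> simp

/-- Here the conditions are `l_i(x) (g x)_i = m_i(x) (g x)_{i+1}`. The coefficients of `x₀²`, `x₀x₁` show
that `(g x)_i` does not involve `x₀`, `x₁`; those of `x₂²`, `x₂x₃` that `(g x)_{i+1}` does not involve
`x₂`, `x₃`. -/
lemma det_quadricSystem_fermat_ne_zero : (quadricSystem fermatP fermatQ).det ≠ 0 := by
  intro h
  obtain ⟨g, hg0, hg⟩ := Matrix.exists_mulVec_eq_zero_iff.2 h
  refine hg0 ?_
  have key : ∀ i : Fin 4, g (i, 0) = 0 ∧ g (i, 1) = 0 ∧ g (i + 1, 2) = 0 ∧ g (i + 1, 3) = 0 := by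
    intro i
    have h0 := congrFun hg (i, 0)
    have h1 := congrFun hg (i, 1)
    have h2 := congrFun hg (i, 2)
    have h3 := congrFun hg (i, 3)
    simp [Matrix.mulVec, dotProduct, quadricSystem, incidenceForm, Fintype.sum_prod_type, fermatP,
      fermatQ, Pi.single_apply, add_mul, Finset.sum_add_distrib] at h0 h1 h2 h3
    simp_all
  ext ⟨i, k⟩
  have h1 := key i
  have h2 := key (i - 1)
  rw [sub_add_cancel] at h2
  fin_cases k
  exacts [h1.1, h1.2.1, h2.2.2.1, h2.2.2.2]

lemma kernelCubicAt_fermat_ne_zero (i : Fin 4) :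
    kernelCubicAt fermatP fermatQ ![1, 0, 2, 0] i ≠ 0 := by
  intro h
  set y : Fin 4 → ℂ := fun p => (linMatAt fermatP fermatQ ![1, 0, 2, 0]).adjugate p 0 with hy
  have hdet : (linMatAt fermatP fermatQ ![1, 0, 2, 0]).det = -15 := by
    rw [← eval_quartic, quartic_fermat]
    simp only [map_add, map_sub, map_pow, eval_X, Matrix.cons_val]
    norm_num
  -- At this point `l_i = 1` and `m_i = 2`, and `y` solves the system with right hand side `det • e₀`.
  -- Hence if one coordinate of `y` vanished, all would.
  have hrow : ∀ j, y j - 2 * y (j + 1) = if j = 0 then -15 else 0 := fun j => by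
    have := congrFun (linMatAt_mulVec_adjugate fermatP fermatQ ![1, 0, 2, 0]) j
    rw [linMatAt_fermat_mulVec, hdet] at this
    simpa [Pi.single_apply] using this
  have hyi : y i = 0 := by
    simpa [kernelCubicAt, fermatP, Pi.single_apply] using h
  have h0 := hrow 0
  have h1 := hrow 1
  have h2 := hrow 2
  have h3 := hrow 3
  simp at h0 h1 h2 h3
  fin_cases i <;> simp at hyi <;> grind

lemma det_stack_fermat_ne_zero {i j : Fin 4} (hij : i ≠ j) :
    (stack (fermatQ i) (fermatQ j)).det ≠ 0 := by
  have h : (stack (fermatQ i) (fermatQ j)).det = -(Complex.I ^ i.1 - Complex.I ^ j.1) ^ 2 := by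
    simp [stack, fermatQ, Matrix.det_succ_row_zero, Fin.sum_univ_succ, Fin.succAbove]
    ring
  rw [h, neg_ne_zero]
  refine pow_ne_zero _ (sub_ne_zero.2 fun he => hij ?_)
  fin_cases i <;> fin_cases j <;> simp [Complex.ext_iff, pow_succ] at he ⊢ <;> norm_num at he

/-! ### Points of general position on the quartic -/

/-- The open conditions on a pair of tuples that are used for the critical locus. -/
structure IsGeneralPair (P Q : Tuple4) : Prop where
  /-- The partial derivatives of the quartic have no common zero. -/
  det_macaulay_ne_zero : (macaulayMatrix fun k => pderiv k (quartic P Q)).det ≠ 0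
  /-- No nonzero `g` satisfies `B_i(g x, x) = 0` for all `i` and `x`. -/
  det_quadricSystem_ne_zero : (quadricSystem P Q).det ≠ 0
  /-- The cubic forms `kernelCubic P Q i` are not zero; the choice of the point is immaterial. -/
  kernelCubicAt_ne_zero : ∀ i, kernelCubicAt P Q ![1, 0, 2, 0] i ≠ 0
  /-- The centers of the projections in `Q` are pairwise skew. -/
  det_stack_ne_zero : ∀ i j, i ≠ j → (stack (Q i) (Q j)).det ≠ 0

lemma exists_polynomial_isGeneralPair : ∃ D : MvPolynomial EntryIndex ℂ, D ≠ 0 ∧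
    ∀ P Q : Tuple4, eval (entries P Q) D ≠ 0 → IsGeneralPair P Q := by
  obtain ⟨D₁, h₁⟩ := exists_eval_entries_eq
    (fun _ _ P Q => (macaulayMatrix fun k => pderiv k (quartic P Q)).det)
    fun _ _ _ _ φ P Q => det_macaulayMatrix_quartic_map φ P Q
  obtain ⟨D₂, h₂⟩ := exists_eval_entries_eq (fun _ _ P Q => (quadricSystem P Q).det)
    fun _ _ _ _ φ P Q => det_quadricSystem_map φ P Q
  choose D₃ h₃ using fun i : Fin 4 => exists_eval_entries_eq
    (fun _ _ P Q => kernelCubicAt P Q ![1, 0, 2, 0] i) fun _ _ _ _ φ P Q => by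
      rw [kernelCubicAt_map]
      congr 1
      ext j
      fin_cases j <;> simp [map_ofNat φ 2]
  choose D₄ h₄ using fun i j : Fin 4 => exists_eval_entries_eq
    (fun _ _ _ Q => (stack (Q i) (Q j)).det) fun _ _ _ _ φ _ Q => det_stack_map φ (Q i) (Q j)
  have heval : ∀ P Q : Tuple4,
      eval (entries P Q) (D₁ * D₂ * (∏ i, D₃ i) * ∏ i, ∏ j, if i = j then 1 else D₄ i j) ≠ 0 ↔
        IsGeneralPair P Q := by
    intro P Q
    simp only [map_mul, map_prod, apply_ite (eval (entries P Q)), map_one, h₁, h₂, h₃, h₄,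
      mul_ne_zero_iff, Finset.prod_ne_zero_iff, Finset.mem_univ, true_imp_iff]
    refine ⟨fun h => ⟨h.1.1.1, h.1.1.2, h.1.2, fun i j hij => ?_⟩,
      fun h => ⟨⟨⟨h.1, h.2⟩, h.3⟩, fun i j => ?_⟩⟩
    · simpa [hij] using h.2 i j
    · split_ifs with hij
      · exact one_ne_zero
      · exact h.4 i j hij
  refine ⟨_, ?_, fun P Q => (heval P Q).1⟩
  intro h0
  refine (heval fermatP fermatQ).2 ⟨det_macaulayMatrix_fermat_ne_zero,
    det_quadricSystem_fermat_ne_zero, kernelCubicAt_fermat_ne_zero,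
    fun i j hij => det_stack_fermat_ne_zero hij⟩ ?_
  rw [h0, map_zero]

variable {P Q : Tuple4}

lemma IsGeneralPair.smooth (h : IsGeneralPair P Q) (v : Fin 4 → ℂ)
    (hv : ∀ k, eval v (pderiv k (quartic P Q)) = 0) : v = 0 :=
  eq_zero_of_det_macaulayMatrix_ne_zero (fun _ => (quartic_isHomogeneous P Q).pderiv)
    h.det_macaulay_ne_zero hv

lemma IsGeneralPair.prime_quartic (h : IsGeneralPair P Q) : Prime (quartic P Q) :=
  (irreducible_of_smooth (quartic_isHomogeneous P Q) (by norm_num) h.smooth).prime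

lemma IsGeneralPair.not_dvd (h : IsGeneralPair P Q) {q : MvPolynomial (Fin 4) ℂ} {d : ℕ}
    (hq : q.IsHomogeneous d) (hd : d < 4) (hq0 : q ≠ 0) : ¬ quartic P Q ∣ q := by
  rintro ⟨r, rfl⟩
  have hF := h.prime_quartic.ne_zero
  have hr : r ≠ 0 := right_ne_zero_of_mul hq0
  have h1 := hq.totalDegree hq0
  rw [totalDegree_mul_of_isDomain hF hr, (quartic_isHomogeneous P Q).totalDegree hF] at h1
  omega

/-- If `B_i(g x, x) = 0` for all `i` and `x`, then `g = 0`: the system of linear equations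
`quadricSystem P Q` expresses part of this condition. -/
lemma IsGeneralPair.eq_zero_of_forall_mulVec (h : IsGeneralPair P Q)
    {g : Matrix (Fin 4) (Fin 4) ℂ} (hg : ∀ x, (linMatAt P Q x).mulVec (g.mulVec x) = 0) :
    g = 0 := by
  -- The polarization of the quadratic form `B_i(g x, x)` vanishes on pairs of unit vectors.
  have hpolar : ∀ i a b, ∑ p, incidenceForm P Q i p a * g p b
      + ∑ p, incidenceForm P Q i p b * g p a = 0 := by
    intro i a b
    have hsum : ∀ x : Fin 4 → ℂ, ∑ p, (∑ k, incidenceForm P Q i p k * x k) * (∑ q, g p q * x q) = 0 :=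
      fun x => congrFun (hg x) i
    have ha := hsum (Pi.single a 1)
    have hb := hsum (Pi.single b 1)
    have hab := hsum (Pi.single a 1 + Pi.single b 1)
    simp only [Pi.add_apply, mul_add, Finset.sum_add_distrib, Pi.single_apply, mul_ite, mul_one,
      mul_zero, Finset.sum_ite_eq', Finset.mem_univ, if_true, add_mul] at ha hb hab
    linear_combination hab - ha - hb
  have hker : (quadricSystem P Q).mulVec (fun pq => g pq.1 pq.2) = 0 := by
    ext ⟨i, t⟩
    rw [Pi.zero_apply, ← hpolar i (![0, 0, 2, 2] t) (![0, 1, 2, 3] t)]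
    simp only [Matrix.mulVec, dotProduct, quadricSystem, Matrix.of_apply, Fintype.sum_prod_type,
      add_mul, Finset.sum_add_distrib, mul_ite, ite_mul, mul_one, mul_zero, zero_mul,
      Finset.sum_ite_eq', Finset.mem_univ, if_true]
  have h0 := Matrix.eq_zero_of_mulVec_eq_zero h.det_quadricSystem_ne_zero hker
  ext p q
  exact congrFun h0 (p, q)

/-- The first column of the adjugate of `linMatAt P Q v`; on the zero locus of the quartic, this is a
solution `y` of `B_i(y, v) = 0` for all `i`. -/
def conjugateVector (P Q : Tuple4) (v : Fin 4 → ℂ) : Fin 4 → ℂ :=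
  fun p => (linMatAt P Q v).adjugate p 0

/-- The vectors on the cone over the quartic where the projections `Q_i` are defined and where
`conjugateVector` represents a point at which the projections `P_i` are defined. To describe an open
condition given by explicit forms, the first coordinates of the images are required not to vanish. -/
def regularVectors (P Q : Tuple4) : Set (Fin 4 → ℂ) :=
  {v | eval v (quartic P Q) = 0 ∧ (∀ i, (Q i).mulVec v 0 ≠ 0) ∧
    ∀ i, (P i).mulVec (conjugateVector P Q v) 0 ≠ 0}

lemma eval_kernelCubic_eq_mulVec (v : Fin 4 → ℂ) (i : Fin 4) :
    eval v (kernelCubic P Q i) = (P i).mulVec (conjugateVector P Q v) 0 := by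
  rw [eval_kernelCubic]
  rfl

lemma IsGeneralPair.row_ne_zero (h : IsGeneralPair P Q) (i : Fin 4) (a : Fin 2) : Q i a ≠ 0 := by
  intro h0
  have hij : i ≠ i + 1 := by fin_cases i <;> decide
  refine h.det_stack_ne_zero i (i + 1) hij (Matrix.det_eq_zero_of_row_eq_zero (a.castLE (by norm_num))
    fun k => ?_)
  fin_cases a <;> exact congrFun h0 k

/-- By the Nullstellensatz and irreducibility, the quartic divides all polynomials that vanish at its
regular points. -/
lemma IsGeneralPair.quartic_dvd (h : IsGeneralPair P Q) {f : MvPolynomial (Fin 4) ℂ}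
    (hf : ∀ v ∈ regularVectors P Q, eval v f = 0) : quartic P Q ∣ f := by
  let l : Fin 4 → MvPolynomial (Fin 4) ℂ := fun i => ∑ k, C (Q i 0 k) * X k
  have hl : ∀ v i, eval v (l i) = (Q i).mulVec v 0 := fun v i => by
    simp [l, Matrix.mulVec, dotProduct]
  -- On the zero locus of the quartic, the second factor vanishes outside the regular points.
  have hvan : f * ((∏ i, l i) * ∏ i, kernelCubic P Q i) ∈
      vanishingIdeal ℂ (zeroLocus ℂ (Ideal.span {quartic P Q})) := by
    intro v hv
    rw [zeroLocus_span] at hv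
    have hFv : eval v (quartic P Q) = 0 := by simpa [aeval_eq_eval] using hv
    by_cases hreg : v ∈ regularVectors P Q
    · simp [aeval_eq_eval, hf v hreg]
    · have : (∃ i, eval v (l i) = 0) ∨ ∃ i, eval v (kernelCubic P Q i) = 0 := by
        by_contra! hcon
        exact hreg ⟨hFv, fun i => hl v i ▸ hcon.1 i,
          fun i => eval_kernelCubic_eq_mulVec v i ▸ hcon.2 i⟩
      simpa [aeval_eq_eval, Finset.prod_eq_zero_iff] using .inr this
  have hprime := h.prime_quartic
  rw [vanishingIdeal_zeroLocus_eq_radical,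
    ((Ideal.span_singleton_prime hprime.ne_zero).2 hprime).radical, Ideal.mem_span_singleton] at hvan
  refine (hprime.dvd_or_dvd hvan).resolve_right fun hdvd => ?_
  rcases hprime.dvd_or_dvd hdvd with hd | hd
  · obtain ⟨i, -, hi⟩ := (hprime.dvd_finsetProd_iff _).1 hd
    refine h.not_dvd (d := 1) (IsHomogeneous.sum _ _ _ fun _ _ => isHomogeneous_C_mul_X _ _)
      (by norm_num) (fun h0 => h.row_ne_zero i 0 ?_) hi
    ext k
    have := hl (Pi.single k 1) i
    rw [show l i = 0 from h0] at this
    simpa using this.symm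
  · obtain ⟨i, -, hi⟩ := (hprime.dvd_finsetProd_iff _).1 hd
    refine h.not_dvd (kernelCubic_isHomogeneous P Q i) (by norm_num) (fun h0 => ?_) hi
    refine h.kernelCubicAt_ne_zero i ?_
    rw [← eval_kernelCubic, h0, map_zero]

lemma linMatAt_mulVec_conjugateVector {v : Fin 4 → ℂ} (hv : eval v (quartic P Q) = 0) :
    (linMatAt P Q v).mulVec (conjugateVector P Q v) = 0 := by
  rw [eval_quartic] at hv
  have h := linMatAt_mulVec_adjugate P Q v
  rw [hv, Pi.single_zero] at h
  exact h

/-- A matrix `g` with `B_i(g v, v) = 0` for all `i` at all regular points `v` is zero, since the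
irreducible quartic lies on no quadric. -/
lemma IsGeneralPair.eq_zero_of_forall_regularVectors (h : IsGeneralPair P Q)
    {g : Matrix (Fin 4) (Fin 4) ℂ}
    (hg : ∀ v ∈ regularVectors P Q, (linMatAt P Q v).mulVec (g.mulVec v) = 0) : g = 0 := by
  refine h.eq_zero_of_forall_mulVec fun x => ?_
  ext i
  -- The quadratic form `B_i(g x, x)`.
  let q : MvPolynomial (Fin 4) ℂ := ∑ p, linMat P Q i p * ∑ k, C (g p k) * X k
  have hq : ∀ v, eval v q = (linMatAt P Q v).mulVec (g.mulVec v) i := fun v => by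
    simp [q, ← eval_linMat, Matrix.mulVec, dotProduct]
  have hhom : q.IsHomogeneous 2 := IsHomogeneous.sum _ _ _ fun p _ =>
    (linMat_isHomogeneous P Q i p).mul
      (IsHomogeneous.sum _ _ _ fun _ _ => isHomogeneous_C_mul_X _ _)
  have hq0 : q = 0 := by
    by_contra hne
    refine h.not_dvd hhom (by norm_num) hne (h.quartic_dvd fun v hv => ?_)
    rw [hq, hg v hv, Pi.zero_apply]
  rw [← hq, hq0, map_zero, Pi.zero_apply]

/-! ### Critical points -/

/-- In a finite-dimensional space, finitely many members of a family of subspaces with zero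
intersection already have zero intersection. -/
lemma exists_finset_forall_mem_imp_eq_zero {ι V : Type*} [AddCommGroup V] [Module ℂ V]
    [FiniteDimensional ℂ V] (N : ι → Submodule ℂ V) (S : Set ι)
    (h : ∀ g, (∀ v ∈ S, g ∈ N v) → g = 0) :
    ∃ s : Finset ι, ↑s ⊆ S ∧ ∀ g, (∀ v ∈ s, g ∈ N v) → g = 0 := by
  classical
  obtain ⟨M, ⟨s, hs, rfl⟩, hmin⟩ := WellFounded.has_min (wellFounded_lt (α := Submodule ℂ V))
    {M | ∃ s : Finset ι, ↑s ⊆ S ∧ M = ⨅ v ∈ s, N v} ⟨_, ∅, by simp, rfl⟩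
  refine ⟨s, hs, fun g hg => h g fun v hv => ?_⟩
  by_contra hgv
  refine hmin (⨅ w ∈ insert v s, N w) ⟨insert v s, ?_, rfl⟩ ?_
  · simpa [Set.insert_subset_iff] using ⟨hv, hs⟩
  · refine SetLike.lt_iff_le_and_exists.2 ⟨?_, g, by simpa [Submodule.mem_iInf] using hg, ?_⟩
    · exact iInf_le_iInf_of_subset (by simp)
    · simp [Submodule.mem_iInf, hgv]

lemma mk_eq_mk_of_cross_eq_zero {a b : Fin 2 → ℂ} (ha : a ≠ 0) (hb : b ≠ 0)
    (h : a 0 * b 1 - a 1 * b 0 = 0) :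
    Projectivization.mk ℂ a ha = Projectivization.mk ℂ b hb := by
  rw [Projectivization.mk_eq_mk_iff']
  by_cases hb0 : b 0 = 0
  · have hb1 : b 1 ≠ 0 := fun hb1 => hb (by ext i; fin_cases i <;> assumption)
    have ha0 : a 0 = 0 := by simpa [hb0, hb1] using h
    refine ⟨a 1 / b 1, ?_⟩
    ext i
    fin_cases i <;> simp [hb0, ha0, hb1]
  · refine ⟨a 0 / b 0, ?_⟩
    ext i
    fin_cases i
    · simp [hb0]
    · simp only [Fin.mk_one, Pi.smul_apply, smul_eq_mul]
      field_simp
      linear_combination h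

lemma sameImage_mk {A B : Matrix (Fin 2) (Fin 4) ℂ} {y x : Fin 4 → ℂ} (hy : y ≠ 0) (hx : x ≠ 0)
    (hA : A.mulVec y ≠ 0) (hB : B.mulVec x ≠ 0)
    (h : A.mulVec y 0 * B.mulVec x 1 - A.mulVec y 1 * B.mulVec x 0 = 0) :
    SameImage A B (Projectivization.mk ℂ y hy) (Projectivization.mk ℂ x hx) := by
  obtain ⟨s, hs⟩ := Projectivization.exists_smul_eq_mk_rep ℂ y hy
  obtain ⟨t, ht⟩ := Projectivization.exists_smul_eq_mk_rep ℂ x hx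
  have hA' : A.mulVec (s • y) = s • A.mulVec y := Matrix.mulVec_smul A s y
  have hB' : B.mulVec (t • x) = t • B.mulVec x := Matrix.mulVec_smul B t x
  unfold SameImage
  rw [← hs, ← ht, hA', hB']
  refine ⟨(smul_ne_zero_iff_ne s).2 hA, (smul_ne_zero_iff_ne t).2 hB, mk_eq_mk_of_cross_eq_zero _ _ ?_⟩
  simp only [Pi.smul_apply, Units.smul_def, smul_eq_mul]
  linear_combination (s : ℂ) * t * h

lemma SameImage.cross_eq_zero {A B : Matrix (Fin 2) (Fin 4) ℂ} {y x : P3} (h : SameImage A B y x) :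
    A.mulVec y.rep 0 * B.mulVec x.rep 1 - A.mulVec y.rep 1 * B.mulVec x.rep 0 = 0 := by
  obtain ⟨hA, hB, h⟩ := h
  obtain ⟨c, hc⟩ := (Projectivization.mk_eq_mk_iff' _ _ _ _ _).1 h
  rw [← hc]
  simp only [Pi.smul_apply, smul_eq_mul]
  ring

lemma eval_quartic_rep_eq_zero {x : P3} (hx : x ∈ criticalPoints P Q) :
    eval x.rep (quartic P Q) = 0 := by
  obtain ⟨N, X, Y, ⟨hXY, -⟩, j, rfl⟩ := hx
  rw [eval_quartic]
  refine Matrix.exists_mulVec_eq_zero_iff.1 ⟨(Y j).rep, (Y j).rep_nonzero, ?_⟩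
  ext i
  rw [linMatAt_mulVec]
  exact (hXY i j).cross_eq_zero

lemma regularVectors_ne_zero {v : Fin 4 → ℂ} (hv : v ∈ regularVectors P Q) : v ≠ 0 := by
  rintro rfl
  simpa using hv.2.1 0

lemma conjugateVector_ne_zero {v : Fin 4 → ℂ} (hv : v ∈ regularVectors P Q) :
    conjugateVector P Q v ≠ 0 := by
  intro h0
  simpa [h0] using hv.2.2 0

/-- Every regular point is critical: together with finitely many others it forms a configuration
whose conjugate is not projectively equivalent to it. -/
lemma IsGeneralPair.mk_mem_criticalPoints (h : IsGeneralPair P Q) {v : Fin 4 → ℂ} (hv0 : v ≠ 0)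
    (hv : v ∈ regularVectors P Q) : Projectivization.mk ℂ v hv0 ∈ criticalPoints P Q := by
  classical
  -- The space of matrices `g` that satisfy the linear equations `B_i(g w, w) = 0`.
  let N : (Fin 4 → ℂ) → Submodule ℂ (Matrix (Fin 4) (Fin 4) ℂ) := fun w => LinearMap.ker
    ((linMatAt P Q w).mulVecLin ∘ₗ (Matrix.mulVecBilin ℂ ℂ).flip w)
  have hN : ∀ w g, g ∈ N w ↔ (linMatAt P Q w).mulVec (g.mulVec w) = 0 := fun w g => by
    simp [N]
  obtain ⟨s, hs, hs0⟩ := exists_finset_forall_mem_imp_eq_zero N (regularVectors P Q)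
    fun g hg => h.eq_zero_of_forall_regularVectors fun w hw => (hN w g).1 (hg w hw)
  have ht : ∀ w ∈ insert v s, w ∈ regularVectors P Q := fun w hw => by
    rcases Finset.mem_insert.1 hw with rfl | hw
    exacts [hv, hs hw]
  let e := (insert v s).equivFin
  have hreg : ∀ j, (e.symm j : Fin 4 → ℂ) ∈ regularVectors P Q := fun j => ht _ (e.symm j).2
  refine ⟨_, fun j => .mk ℂ _ (regularVectors_ne_zero (hreg j)),
    fun j => .mk ℂ _ (conjugateVector_ne_zero (hreg j)), ⟨fun i j => ?_, ?_⟩,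
    e ⟨v, Finset.mem_insert_self v s⟩, by simp⟩
  · refine sameImage_mk _ _ (fun h0 => (hreg j).2.2 i (by rw [h0, Pi.zero_apply]))
      (fun h0 => (hreg j).2.1 i (by rw [h0, Pi.zero_apply])) ?_
    rw [← linMatAt_mulVec, linMatAt_mulVec_conjugateVector (hreg j).1, Pi.zero_apply]
  · rintro ⟨g, hg⟩
    have hg0 : LinearMap.toMatrix' g.toLinearMap = 0 := hs0 _ fun w hw => by
      rw [hN, LinearMap.toMatrix'_mulVec]
      have hgw := hg (e ⟨w, Finset.mem_insert_of_mem hw⟩)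
      rw [Projectivization.map_mk, Projectivization.mk_eq_mk_iff'] at hgw
      obtain ⟨c, hc⟩ := hgw
      simp only [Equiv.symm_apply_apply] at hc
      rw [← hc, Matrix.mulVec_smul,
        linMatAt_mulVec_conjugateVector (hs hw).1, smul_zero]
    have hgv := LinearMap.toMatrix'_mulVec g.toLinearMap v
    rw [hg0, Matrix.zero_mulVec] at hgv
    exact hv0 (g.map_eq_zero_iff.1 hgv.symm)

lemma eval_quartic_smul (t : ℂ) (v : Fin 4 → ℂ) :
    eval (t • v) (quartic P Q) = t ^ 4 * eval v (quartic P Q) :=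
  eval_smul_of_isHomogeneous (quartic_isHomogeneous P Q) t v

lemma eval_quartic_eq_zero_of_mk_mem {v : Fin 4 → ℂ} (hv : v ≠ 0)
    (h : Projectivization.mk ℂ v hv ∈ criticalPoints P Q) : eval v (quartic P Q) = 0 := by
  obtain ⟨t, ht⟩ := Projectivization.exists_smul_eq_mk_rep ℂ v hv
  have h0 := eval_quartic_rep_eq_zero h
  rw [← ht, Units.smul_def, eval_quartic_smul] at h0
  simpa using h0

lemma IsGeneralPair.projIdeal_criticalPoints (h : IsGeneralPair P Q) :
    projIdeal (criticalPoints P Q) = Ideal.span {quartic P Q} := by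
  refine le_antisymm (fun f hf => ?_) ?_
  · rw [Ideal.mem_span_singleton]
    exact h.quartic_dvd fun v hv => hf v (regularVectors_ne_zero hv) (h.mk_mem_criticalPoints _ hv)
  · rw [Ideal.span_singleton_le_iff_mem]
    exact fun v hv hS => eval_quartic_eq_zero_of_mk_mem hv hS

lemma projIdeal_projZeros_projIdeal (S : Set P3) :
    projIdeal (projZeros (projIdeal S)) = projIdeal S := by
  refine le_antisymm (fun f hf v hv hS => hf v hv fun g hg w hw hwv => ?_)
    fun f hf v hv hS => hS f hf v hv rfl
  exact hg w hw (hwv ▸ hS)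

lemma IsGeneralPair.projIdeal_criticalLocus (h : IsGeneralPair P Q) :
    projIdeal (criticalLocus P Q) = Ideal.span {quartic P Q} :=
  (projIdeal_projZeros_projIdeal _).trans h.projIdeal_criticalPoints

lemma IsGeneralPair.criticalLocus_eq (h : IsGeneralPair P Q) :
    criticalLocus P Q = projZeros (Ideal.span {quartic P Q}) := by
  rw [criticalLocus, h.projIdeal_criticalPoints]

lemma IsGeneralPair.isSmoothQuarticDeterminantal (h : IsGeneralPair P Q) :
    IsSmoothQuarticDeterminantal (criticalLocus P Q) := by
  refine ⟨linMat P Q, linMat_isHomogeneous P Q, h.prime_quartic.ne_zero, quartic_isHomogeneous P Q,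
    h.projIdeal_criticalLocus, h.criticalLocus_eq, fun v hv _ => ?_⟩
  by_contra! hcon
  exact hv (h.smooth v hcon)

/-! ### The centers -/

lemma isProjLine_center {A : Matrix (Fin 2) (Fin 4) ℂ} (hA : A.rank = 2) :
    IsProjLine (center A) := by
  refine ⟨LinearMap.ker A.mulVecLin, ?_, ?_⟩
  · have h := A.mulVecLin.finrank_range_add_finrank_ker
    rw [Matrix.rank] at hA
    simp [hA] at h
    omega
  · ext x
    rw [center, Set.mem_ofPred_eq, Set.mem_ofPred_eq, Projectivization.submodule_eq,
      Submodule.span_singleton_le_iff_mem]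
    rfl

/-- On the center of `Q_i` the `i`-th row of `linMat P Q` vanishes. -/
lemma IsGeneralPair.center_subset (h : IsGeneralPair P Q) (i : Fin 4) :
    center (Q i) ⊆ criticalLocus P Q := by
  intro x hx
  have hx' : (Q i).mulVec x.rep = 0 := hx
  rw [h.criticalLocus_eq]
  intro f hf v hv hvx
  obtain ⟨r, rfl⟩ := Ideal.mem_span_singleton.1 hf
  obtain ⟨t, ht⟩ := Projectivization.exists_smul_eq_mk_rep ℂ v hv
  have hQv : (Q i).mulVec v = 0 := by
    rw [← hvx, ← ht, Units.smul_def, Matrix.mulVec_smul] at hx'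
    exact (smul_eq_zero.1 hx').resolve_left t.ne_zero
  have h0 : eval v (quartic P Q) = 0 := by
    rw [eval_quartic]
    refine Matrix.det_eq_zero_of_row_eq_zero i fun p => ?_
    have := linMatAt_mulVec P Q v (Pi.single p 1) i
    simpa [hQv] using this
  rw [map_mul, h0, zero_mul]

lemma IsGeneralPair.disjoint_center (h : IsGeneralPair P Q) {i j : Fin 4} (hij : i ≠ j) :
    Disjoint (center (Q i)) (center (Q j)) := by
  rw [Set.disjoint_left]
  intro x hi hj
  refine x.rep_nonzero (Matrix.eq_zero_of_mulVec_eq_zero (h.det_stack_ne_zero i j hij) ?_)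
  have hi' : (Q i).mulVec x.rep = 0 := hi
  have hj' : (Q j).mulVec x.rep = 0 := hj
  ext a
  fin_cases a
  exacts [congrFun hi' 0, congrFun hi' 1, congrFun hj' 0, congrFun hj' 1]

/-! ### The maximal minors of the `8 × 8` matrix -/

/-- The determinant of a block matrix with commuting blocks `B`, `D` in the second column. -/
lemma det_fromBlocks_of_commute {R : Type*} [CommRing R] [IsDomain R] {n : Type*} [Fintype n]
    [DecidableEq n] (A B C D : Matrix n n R) (hBD : D * B = B * D) (hD : D.det ≠ 0) :
    (Matrix.fromBlocks A B C D).det = (D * A - B * C).det := by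
  have h : Matrix.fromBlocks D (-B) 0 1 * Matrix.fromBlocks A B C D
      = Matrix.fromBlocks (D * A - B * C) 0 C D := by
    rw [Matrix.fromBlocks_multiply]
    simp [hBD, sub_eq_add_neg]
  have h2 := congrArg Matrix.det h
  rw [Matrix.det_mul, Matrix.det_fromBlocks_zero₂₁, Matrix.det_fromBlocks_zero₁₂, Matrix.det_one,
    mul_one, mul_comm] at h2
  exact mul_right_cancel₀ hD h2

/-- The identification of rows with columns that matches the `a`-th row of the `i`-th pair with the
`i`-th column of the `a`-th block. -/
def rowEquiv : Fin 4 × Fin 2 ≃ Fin 4 ⊕ Fin 4 :=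
  (Equiv.prodComm _ _).trans ((Equiv.prodCongr finTwoEquiv (Equiv.refl _)).trans
    (Equiv.boolProdEquivSum (Fin 4)))

lemma IsGeneralPair.det_criticalMatrix_submatrix (h : IsGeneralPair P Q) :
    ((criticalMatrix P Q).submatrix id rowEquiv).det = quartic P Q := by
  let l : Fin 2 → Fin 4 → MvPolynomial (Fin 4) ℂ := fun a i => ∑ k, C (Q i a k) * X k
  let M : Fin 2 → Matrix (Fin 4) (Fin 4) (MvPolynomial (Fin 4) ℂ) :=
    fun a => Matrix.of fun i p => C (P i a p)
  have hl : (Matrix.diagonal (l 1)).det ≠ 0 := by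
    rw [Matrix.det_diagonal, Finset.prod_ne_zero_iff]
    intro i _ h0
    refine h.row_ne_zero i 1 ?_
    ext k
    simpa [l, Pi.single_apply] using congrArg (eval (Pi.single k 1)) h0
  have hblocks : ((criticalMatrix P Q).submatrix id rowEquiv).submatrix rowEquiv.symm rowEquiv.symm
      = Matrix.fromBlocks (M 0) (Matrix.diagonal (l 0)) (M 1) (Matrix.diagonal (l 1)) := by
    rw [Matrix.submatrix_submatrix, Equiv.self_comp_symm, Function.id_comp]
    ext1 r c
    rcases r with i | i <;> rcases c with p | p
    · rfl
    · rw [Matrix.fromBlocks_apply₁₂, Matrix.diagonal_apply]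
      exact if_congr eq_comm rfl rfl
    · rfl
    · rw [Matrix.fromBlocks_apply₂₂, Matrix.diagonal_apply]
      exact if_congr eq_comm rfl rfl
  have hdet := Matrix.det_submatrix_equiv_self rowEquiv.symm
    ((criticalMatrix P Q).submatrix id rowEquiv)
  rw [hblocks, det_fromBlocks_of_commute _ _ _ _ (by simp [mul_comm]) hl] at hdet
  rw [← hdet, quartic]
  congr 1
  ext1 i p
  simp only [Matrix.sub_apply, Matrix.diagonal_mul, M, l, linMat, incidenceForm, Matrix.of_apply,
    Fin.sum_univ_four, C_sub, C_mul]
  ring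

lemma IsGeneralPair.span_criticalMinors (h : IsGeneralPair P Q) :
    Ideal.span (criticalMinors P Q) = Ideal.span {quartic P Q} := by
  refine le_antisymm (Ideal.span_le.2 ?_) (Ideal.span_mono ?_)
  · rintro _ ⟨e, rfl⟩
    -- Another identification of the rows with the columns changes the determinant by a sign.
    have he : (criticalMatrix P Q).submatrix id e
        = ((criticalMatrix P Q).submatrix id rowEquiv).submatrix id (e.trans rowEquiv.symm) := by
      ext1 r c
      simp
    rw [he, Matrix.det_permute', h.det_criticalMatrix_submatrix]
    exact Ideal.mul_mem_left _ _ (Ideal.mem_span_singleton_self _)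
  · rw [Set.singleton_subset_iff]
    exact ⟨rowEquiv, h.det_criticalMatrix_submatrix.symm⟩

theorem mainTheorem9 :
    ForGeneralTuples (fun P Q =>
      IsSmoothQuarticDeterminantal (criticalLocus P Q) ∧
      projIdeal (criticalLocus P Q) = Ideal.span (criticalMinors P Q) ∧
      (∀ i, IsProjLine (center (Q i)) ∧ center (Q i) ⊆ criticalLocus P Q) ∧
      (∀ i j, i ≠ j → Disjoint (center (Q i)) (center (Q j)))) := by
  obtain ⟨D, hD, hgen⟩ := exists_polynomial_isGeneralPair
  refine ⟨D, hD, fun P Q _ hQ hPQ => ?_⟩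
  have h := hgen P Q hPQ
  exact ⟨h.isSmoothQuarticDeterminantal,
    h.projIdeal_criticalLocus.trans h.span_criticalMinors.symm,
    fun i => ⟨isProjLine_center (hQ i), h.center_subset i⟩, fun i j hij => h.disjoint_center hij⟩
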